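/- Let $p$ be a prime and let $\mathbb{K}$ be a field of characteristic zero. For finite groups $H,G$, a finite $(H,G)$-biset is called $p$-bifree if the stabilizers in $H$ and the stabilizers in $G$ of all its elements are $p'$-groups (that is, of order prime to $p$). Let $B^\Delta(H,G)$ be the Grothendieck group of finite $p$-bifree $(H,G)$-bisets with respect to disjoint unions, and $\mathbb{K}B^\Delta(H,G)=\mathbb{K}\otimes_{\mathbb{Z}}B^\Delta(H,G)$. Let $\mathbb{K}\mathcal{C}^\Delta$ be the $\mathbb{K}$-linear category whose objects are the finite groups, with $\mathrm{Hom}(G,H)=\mathbb{K}B^\Delta(H,G)$ and composition $\cdot$ induced by $(X,Y)\mapsto X\times_H Y$. Write $1$ for the trivial group and regard $\mathbb{K}$ as the trivial module of $\mathbb{K}\mathrm{Out}(1)\cong E_1:=\mathbb{K}B^\Delta(1,1)$. The simple $p$-bifree biset functor $S^\Delta_{1,\mathbb{K}}:\mathbb{K}\mathcal{C}^\Delta\to{}_{\mathbb{K}}\mathrm{Mod}$ is the quotient $L_{1,\mathbb{K}}/J_{1,\mathbb{K}}$, where, for a finite group $G$, \[ L_{1,\mathbb{K}}(G)=\mathbb{K}B^\Delta(G,1)\otimes_{E_1}\mathbb{K},\qquad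 J_{1,\mathbb{K}}(G)=\Bigl\{\sum_i x_i\otimes v_i\in L_{1,\mathbb{K}}(G)\;\Big|\;\sum_i (y\cdot x_i)\,v_i=0\ \text{ for all } y\in\mathbb{K}B^\Delta(1,G)\Bigr\}. \] Then for every finite group $G$ the $\mathbb{K}$-vector space $S^\Delta_{1,\mathbb{K}}(G)$ is finite-dimensional, and $\dim_{\mathbb{K}}S^\Delta_{1,\mathbb{K}}(G)$ is equal to the number of $G$-conjugacy classes of cyclic $p'$-subgroups of $G$. -/

import Mathlib

open CategoryTheory MulOpposite
open scoped TensorProduct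

universe u v w

noncomputable section

namespace PBifree

/-- A group is a `p'`-group if its order is prime to `p` (only used for finite groups). -/
def IsPPrimeGroup (p : ℕ) (A : Type*) [Group A] : Prop :=
  (Nat.card A).Coprime p

/-- A finite `p`-bifree `(H, G)`-biset: a finite set with commuting left `H`-action and right
`G`-action (a right action is an action of `Gᵐᵒᵖ`) such that all left stabilizers
`{h | h • x = x}` and all right stabilizers `{g | x • g = x}` are `p'`-groups. -/
structure Biset (p : ℕ) (H G : Type u) [Group H] [Group G] where
  carrier : Type u
  [finite : Finite carrier]
  [left : MulAction H carrier]
  [right : MulAction Gᵐᵒᵖ carrier]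
  [comm : SMulCommClass H Gᵐᵒᵖ carrier]
  left_stabilizer (x : carrier) : IsPPrimeGroup p (MulAction.stabilizer H x)
  right_stabilizer (x : carrier) : IsPPrimeGroup p (MulAction.stabilizer Gᵐᵒᵖ x)

attribute [instance] Biset.finite Biset.left Biset.right Biset.comm

section Bisets

variable {p : ℕ} {K H G F : Type u} [Group K] [Group H] [Group G] [Group F]

/-- An isomorphism of `(H, G)`-bisets. -/
structure BisetIso (X Y : Biset p H G) extends X.carrier ≃ Y.carrier where
  map_left (h : H) (x : X.carrier) : toFun (h • x) = h • toFun x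
  map_right (g : Gᵐᵒᵖ) (x : X.carrier) : toFun (g • x) = g • toFun x

instance bisetSetoid (p : ℕ) (H G : Type u) [Group H] [Group G] : Setoid (Biset p H G) where
  r X Y := Nonempty (BisetIso X Y)
  iseqv :=
    { refl := fun X => ⟨⟨Equiv.refl _, fun _ _ => rfl, fun _ _ => rfl⟩⟩
      symm := by
        rintro X Y ⟨e⟩
        refine ⟨⟨e.toEquiv.symm, fun h y => ?_, fun g y => ?_⟩⟩
        · apply e.toEquiv.injective
          have := e.map_left h (e.toEquiv.symm y)
          simp_all
        · apply e.toEquiv.injective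
          have := e.map_right g (e.toEquiv.symm y)
          simp_all
      trans := by
        rintro X Y Z ⟨e⟩ ⟨f⟩
        refine ⟨⟨e.toEquiv.trans f.toEquiv, fun h y => ?_, fun g y => ?_⟩⟩
        · have h1 := e.map_left h y
          have h2 := f.map_left h (e.toEquiv y)
          simp_all
        · have h1 := e.map_right g y
          have h2 := f.map_right g (e.toEquiv y)
          simp_all }

/-- Isomorphism classes of `p`-bifree `(H, G)`-bisets. -/
def IsoClass (p : ℕ) (H G : Type u) [Group H] [Group G] : Type (u + 1) :=
  Quotient (bisetSetoid p H G)

/-! ### Disjoint union -/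

theorem stabilizer_inl {A X Y : Type*} [Group A] [MulAction A X] [MulAction A Y] (x : X) :
    MulAction.stabilizer A (Sum.inl x : X ⊕ Y) = MulAction.stabilizer A x := by
  ext a; simp [MulAction.mem_stabilizer_iff]

theorem stabilizer_inr {A X Y : Type*} [Group A] [MulAction A X] [MulAction A Y] (y : Y) :
    MulAction.stabilizer A (Sum.inr y : X ⊕ Y) = MulAction.stabilizer A y := by
  ext a; simp [MulAction.mem_stabilizer_iff]

/-- The disjoint union of two bisets. -/
def Biset.sum (X Y : Biset p H G) : Biset p H G where
  carrier := X.carrier ⊕ Y.carrier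
  left_stabilizer := by
    rintro (x | y)
    · rw [stabilizer_inl]; exact X.left_stabilizer x
    · rw [stabilizer_inr]; exact Y.left_stabilizer y
  right_stabilizer := by
    rintro (x | y)
    · rw [stabilizer_inl]; exact X.right_stabilizer x
    · rw [stabilizer_inr]; exact Y.right_stabilizer y

/-- The empty biset. -/
def Biset.empty (p : ℕ) (H G : Type u) [Group H] [Group G] : Biset p H G where
  carrier := PEmpty
  left := { smul := fun _ x => x, one_smul := fun _ => rfl, mul_smul := fun _ _ x => x.elim }
  right := { smul := fun _ x => x, one_smul := fun _ => rfl, mul_smul := fun _ _ x => x.elim }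
  comm := @SMulCommClass.mk _ _ _ ⟨fun _ x => x⟩ ⟨fun _ x => x⟩ fun _ _ x => x.elim
  left_stabilizer x := x.elim
  right_stabilizer x := x.elim

instance : Add (IsoClass p H G) where
  add := Quotient.map₂ Biset.sum (by
    rintro X X' ⟨e⟩ Y Y' ⟨f⟩
    refine ⟨⟨Equiv.sumCongr e.toEquiv f.toEquiv, ?_, ?_⟩⟩
    · rintro h (x | y)
      · exact congrArg Sum.inl (e.map_left h x)
      · exact congrArg Sum.inr (f.map_left h y)
    · rintro h (x | y)
      · exact congrArg Sum.inl (e.map_right h x)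
      · exact congrArg Sum.inr (f.map_right h y))

instance : Zero (IsoClass p H G) where
  zero := Quotient.mk _ (Biset.empty p H G)

theorem IsoClass.add_comm' (a b : IsoClass p H G) : a + b = b + a := by
  induction a using Quotient.inductionOn with | _ X
  induction b using Quotient.inductionOn with | _ Y
  refine Quotient.sound ⟨⟨Equiv.sumComm _ _, ?_, ?_⟩⟩ <;> rintro h (x | y) <;> rfl

theorem IsoClass.zero_add' (a : IsoClass p H G) : 0 + a = a := by
  induction a using Quotient.inductionOn with | _ X
  refine Quotient.sound ⟨⟨Equiv.emptySum PEmpty X.carrier, ?_, ?_⟩⟩ <;>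
    rintro h (x | y) <;> first | exact x.elim | rfl

instance : AddCommMonoid (IsoClass p H G) where
  add_assoc a b c := by
    induction a using Quotient.inductionOn with | _ X
    induction b using Quotient.inductionOn with | _ Y
    induction c using Quotient.inductionOn with | _ Z
    refine Quotient.sound ⟨⟨Equiv.sumAssoc _ _ _, ?_, ?_⟩⟩ <;> rintro h ((x | y) | z) <;> rfl
  zero_add := IsoClass.zero_add'
  add_zero a := by rw [IsoClass.add_comm', IsoClass.zero_add']
  add_comm := IsoClass.add_comm'
  nsmul := nsmulRec

/-! ### Composition of bisets -/

/-- The relation `(x h, y) ∼ (x, h y)` on `X × Y`. -/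
def compSetoid (X : Biset p K H) (Y : Biset p H G) : Setoid (X.carrier × Y.carrier) where
  r a b := ∃ h : H, b.1 = op h • a.1 ∧ a.2 = h • b.2
  iseqv :=
    { refl := fun a => ⟨1, by simp, by simp⟩
      symm := by
        rintro a b ⟨h, h1, h2⟩
        exact ⟨h⁻¹, by simp [h1], by simp [h2]⟩
      trans := by
        rintro a b c ⟨h, h1, h2⟩ ⟨k, k1, k2⟩
        exact ⟨h * k, by rw [k1, h1, op_mul, mul_smul], by rw [h2, k2, mul_smul]⟩ }

instance compLeft (X : Biset p K H) (Y : Biset p H G) :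
    MulAction K (Quotient (compSetoid X Y)) where
  smul k := Quotient.map (fun a => (k • a.1, a.2)) (by
    rintro a b ⟨h, h1, h2⟩
    exact ⟨h, by rw [h1, smul_comm], h2⟩)
  one_smul q := by
    induction q using Quotient.inductionOn with | _ a
    exact congrArg (Quotient.mk _) (Prod.ext (one_smul K a.1) rfl)
  mul_smul k l q := by
    induction q using Quotient.inductionOn with | _ a
    exact congrArg (Quotient.mk _) (Prod.ext (mul_smul k l a.1) rfl)

instance compRight (X : Biset p K H) (Y : Biset p H G) :
    MulAction Gᵐᵒᵖ (Quotient (compSetoid X Y)) where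
  smul g := Quotient.map (fun a => (a.1, g • a.2)) (by
    rintro a b ⟨h, h1, h2⟩
    exact ⟨h, h1, by rw [h2, ← smul_comm h g b.2]⟩)
  one_smul q := by
    induction q using Quotient.inductionOn with | _ a
    exact congrArg (Quotient.mk _) (Prod.ext rfl (one_smul Gᵐᵒᵖ a.2))
  mul_smul k l q := by
    induction q using Quotient.inductionOn with | _ a
    exact congrArg (Quotient.mk _) (Prod.ext rfl (mul_smul k l a.2))

theorem coprime_of_forall_pow {A : Type*} [Group A] {p n : ℕ} (hn : n.Coprime p)
    (S : Subgroup A) [Finite S] (h : ∀ a ∈ S, a ^ n = 1) : IsPPrimeGroup p S := by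
  refine Nat.coprime_of_dvd fun q hq hS hp => ?_
  have := Fact.mk hq
  obtain ⟨a, ha⟩ := exists_prime_orderOf_dvd_card' q hS
  have h1 : a ^ n = 1 := Subtype.ext (by simpa using h a a.2)
  have h2 : q ∣ n := ha ▸ orderOf_dvd_of_pow_eq_one h1
  exact hq.one_lt.ne' (Nat.eq_one_of_dvd_coprimes hn h2 hp)

theorem pow_smul_of_smul_eq {A B X : Type*} [Group A] [Group B] [MulAction A X] [MulAction B X]
    [SMulCommClass A B X] {a : A} {b : B} {x : X} (h : a • x = b • x) (n : ℕ) :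
    a ^ n • x = b ^ n • x := by
  induction n with
  | zero => simp
  | succ n ih => rw [pow_succ, mul_smul, h, smul_comm, ih, ← mul_smul, ← pow_succ']

theorem pow_card_stabilizer {A Y : Type*} [Group A] [MulAction A Y] (y : Y) (h : A)
    (hy : h • y = y) : h ^ Nat.card (MulAction.stabilizer A y) = 1 := by
  have := pow_card_eq_one' (x := (⟨h, hy⟩ : MulAction.stabilizer A y))
  simpa using congrArg Subtype.val this

/-- The composition `X ×_H Y` of a `(K, H)`-biset and an `(H, G)`-biset. -/
def Biset.comp [Finite K] [Finite G] (X : Biset p K H) (Y : Biset p H G) : Biset p K G where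
  carrier := Quotient (compSetoid X Y)
  comm := ⟨fun k g q => by
    induction q using Quotient.inductionOn with | _ a
    rfl⟩
  left_stabilizer q := by
    induction q using Quotient.inductionOn with | _ a
    obtain ⟨x, y⟩ := a
    refine coprime_of_forall_pow
      (Nat.Coprime.mul_left (Y.left_stabilizer y) (X.left_stabilizer x)) _ fun k hk => ?_
    obtain ⟨h, h1, h2⟩ := Quotient.exact (MulAction.mem_stabilizer_iff.mp hk)
    replace h1 : x = op h • k • x := h1
    replace h2 : y = h • y := h2
    have hn := pow_card_stabilizer y h h2.symm
    have hx : k • x = (op h)⁻¹ • x := by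
      rw [eq_inv_smul_iff]; exact h1.symm
    have hx' := pow_smul_of_smul_eq hx (Nat.card (MulAction.stabilizer H y))
    rw [inv_pow, ← op_pow, hn, op_one, inv_one, one_smul] at hx'
    rw [pow_mul]
    exact pow_card_stabilizer x _ hx'
  right_stabilizer q := by
    induction q using Quotient.inductionOn with | _ a
    obtain ⟨x, y⟩ := a
    have : Finite Gᵐᵒᵖ := Finite.of_equiv G opEquiv
    refine coprime_of_forall_pow
      (Nat.Coprime.mul_left (X.right_stabilizer x) (Y.right_stabilizer y)) _ fun g hg => ?_
    obtain ⟨h, h1, h2⟩ := Quotient.exact (MulAction.mem_stabilizer_iff.mp hg)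
    replace h1 : x = op h • x := h1
    replace h2 : g • y = h • y := h2
    have hn := pow_card_stabilizer x (op h) h1.symm
    have hn' : h ^ Nat.card (MulAction.stabilizer Hᵐᵒᵖ x) = 1 := by
      rw [← op_pow] at hn
      exact op_injective hn
    have : SMulCommClass Gᵐᵒᵖ H Y.carrier := SMulCommClass.symm _ _ _
    have hy' := pow_smul_of_smul_eq h2 (Nat.card (MulAction.stabilizer Hᵐᵒᵖ x))
    rw [hn', one_smul] at hy'
    rw [pow_mul]
    exact pow_card_stabilizer y _ hy'

/-- The identity biset: `G` with left and right multiplication. -/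
def Biset.id (p : ℕ) (G : Type u) [Group G] [Finite G] : Biset p G G where
  carrier := G
  left_stabilizer x := by
    have : MulAction.stabilizer G x = ⊥ := by
      ext a; simp
    rw [this]; simp [IsPPrimeGroup]
  right_stabilizer x := by
    have : MulAction.stabilizer Gᵐᵒᵖ x = ⊥ := by
      ext a; simp
    rw [this]; simp [IsPPrimeGroup]

theorem Biset.comp_congr [Finite K] [Finite G] {X X' : Biset p K H} {Y Y' : Biset p H G}
    (e : BisetIso X X') (f : BisetIso Y Y') : X.comp Y ≈ X'.comp Y' := by
  refine ⟨⟨Quotient.congr (Equiv.prodCongr e.toEquiv f.toEquiv) ?_, ?_, ?_⟩⟩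
  · rintro ⟨x, y⟩ ⟨x', y'⟩
    refine exists_congr fun h => and_congr ?_ ?_
    · exact e.toEquiv.injective.eq_iff.symm.trans (Eq.congr_right (e.map_right (op h) x))
    · exact f.toEquiv.injective.eq_iff.symm.trans (Eq.congr_right (f.map_left h y'))
  · intro k q
    induction q using Quotient.inductionOn with | _ a
    exact congrArg (Quotient.mk _) (Prod.ext (e.map_left k a.1) rfl)
  · intro k q
    induction q using Quotient.inductionOn with | _ a
    exact congrArg (Quotient.mk _) (Prod.ext rfl (f.map_right k a.2))

/-- Composition of isomorphism classes of bisets. -/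
def IsoClass.comp [Finite K] [Finite G] : IsoClass p K H → IsoClass p H G → IsoClass p K G :=
  Quotient.map₂ Biset.comp fun _ _ ⟨e⟩ _ _ ⟨f⟩ => Biset.comp_congr e f

theorem IsoClass.zero_comp [Finite K] [Finite G] (b : IsoClass p H G) :
    IsoClass.comp (0 : IsoClass p K H) b = 0 := by
  induction b using Quotient.inductionOn with | _ Y
  refine Quotient.sound ⟨⟨⟨Quotient.lift (fun a => a.1) fun a => a.1.elim, fun x => x.elim,
    ?_, fun x => x.elim⟩, ?_, ?_⟩⟩
  · intro q
    induction q using Quotient.inductionOn with | _ a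
    exact a.1.elim
  all_goals
    intro k q
    induction q using Quotient.inductionOn with | _ a
    exact a.1.elim

theorem IsoClass.comp_zero [Finite K] [Finite G] (a : IsoClass p K H) :
    IsoClass.comp a (0 : IsoClass p H G) = 0 := by
  induction a using Quotient.inductionOn with | _ Y
  refine Quotient.sound ⟨⟨⟨Quotient.lift (fun a => a.2) fun a => a.2.elim, fun x => x.elim,
    ?_, fun x => x.elim⟩, ?_, ?_⟩⟩
  · intro q
    induction q using Quotient.inductionOn with | _ a
    exact a.2.elim
  all_goals
    intro k q
    induction q using Quotient.inductionOn with | _ a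
    exact a.2.elim

theorem IsoClass.add_comp [Finite K] [Finite G] (a a' : IsoClass p K H) (b : IsoClass p H G) :
    IsoClass.comp (a + a') b = IsoClass.comp a b + IsoClass.comp a' b := by
  induction a using Quotient.inductionOn with | _ X
  induction a' using Quotient.inductionOn with | _ X'
  induction b using Quotient.inductionOn with | _ Y
  refine Quotient.sound ⟨⟨⟨Quotient.lift
      (fun a : (X.carrier ⊕ X'.carrier) × Y.carrier =>
        (Sum.map (fun x => Quotient.mk (compSetoid X Y) (x, a.2))
          (fun x => Quotient.mk (compSetoid X' Y) (x, a.2)) a.1)) ?_,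
    Sum.elim
      (Quotient.map (fun a => (Sum.inl a.1, a.2)) ?_)
      (Quotient.map (fun a => (Sum.inr a.1, a.2)) ?_), ?_, ?_⟩, ?_, ?_⟩⟩
  · rintro ⟨x | x, y⟩ ⟨x' | x', y'⟩ ⟨h, h1, h2⟩
    · exact congrArg Sum.inl (Quotient.sound ⟨h, Sum.inl_injective h1, h2⟩)
    · exact absurd h1 (by rintro ⟨⟩)
    · exact absurd h1 (by rintro ⟨⟩)
    · exact congrArg Sum.inr (Quotient.sound ⟨h, Sum.inr_injective h1, h2⟩)
  · rintro a b ⟨h, h1, h2⟩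
    exact ⟨h, congrArg Sum.inl h1, h2⟩
  · rintro a b ⟨h, h1, h2⟩
    exact ⟨h, congrArg Sum.inr h1, h2⟩
  · intro q
    induction q using Quotient.inductionOn with | _ a
    obtain ⟨x | x, y⟩ := a <;> rfl
  · rintro (q | q) <;> induction q using Quotient.inductionOn with | _ a <;> rfl
  all_goals
    intro k q
    induction q using Quotient.inductionOn with | _ a
    obtain ⟨x | x, y⟩ := a <;> rfl

theorem IsoClass.comp_add [Finite K] [Finite G] (a : IsoClass p K H) (b b' : IsoClass p H G) :
    IsoClass.comp a (b + b') = IsoClass.comp a b + IsoClass.comp a b' := by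
  induction a using Quotient.inductionOn with | _ X
  induction b using Quotient.inductionOn with | _ Y
  induction b' using Quotient.inductionOn with | _ Y'
  refine Quotient.sound ⟨⟨⟨Quotient.lift
      (fun a : X.carrier × (Y.carrier ⊕ Y'.carrier) =>
        (Sum.map (fun y => Quotient.mk (compSetoid X Y) (a.1, y))
          (fun y => Quotient.mk (compSetoid X Y') (a.1, y)) a.2)) ?_,
    Sum.elim
      (Quotient.map (fun a => (a.1, Sum.inl a.2)) ?_)
      (Quotient.map (fun a => (a.1, Sum.inr a.2)) ?_), ?_, ?_⟩, ?_, ?_⟩⟩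
  · rintro ⟨x, y | y⟩ ⟨x', y' | y'⟩ ⟨h, h1, h2⟩
    · exact congrArg Sum.inl (Quotient.sound ⟨h, h1, Sum.inl_injective h2⟩)
    · exact absurd h2 (by rintro ⟨⟩)
    · exact absurd h2 (by rintro ⟨⟩)
    · exact congrArg Sum.inr (Quotient.sound ⟨h, h1, Sum.inr_injective h2⟩)
  · rintro a b ⟨h, h1, h2⟩
    exact ⟨h, h1, congrArg Sum.inl h2⟩
  · rintro a b ⟨h, h1, h2⟩
    exact ⟨h, h1, congrArg Sum.inr h2⟩
  · intro q
    induction q using Quotient.inductionOn with | _ a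
    obtain ⟨x, y | y⟩ := a <;> rfl
  · rintro (q | q) <;> induction q using Quotient.inductionOn with | _ a <;> rfl
  all_goals
    intro k q
    induction q using Quotient.inductionOn with | _ a
    obtain ⟨x, y | y⟩ := a <;> rfl

theorem IsoClass.comp_assoc [Finite K] [Finite H] [Finite G] [Finite F] (a : IsoClass p K H)
    (b : IsoClass p H G) (c : IsoClass p G F) :
    IsoClass.comp (IsoClass.comp a b) c = IsoClass.comp a (IsoClass.comp b c) := by
  induction a using Quotient.inductionOn with | _ X
  induction b using Quotient.inductionOn with | _ Y
  induction c using Quotient.inductionOn with | _ Z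
  refine Quotient.sound ⟨⟨⟨Quotient.lift
      (fun a : Quotient (compSetoid X Y) × Z.carrier =>
        Quotient.lift (fun t : X.carrier × Y.carrier =>
          Quotient.mk (compSetoid X (Y.comp Z)) (t.1, Quotient.mk (compSetoid Y Z) (t.2, a.2)))
          ?_ a.1) ?_,
    Quotient.lift
      (fun a : X.carrier × Quotient (compSetoid Y Z) =>
        Quotient.lift (fun t : Y.carrier × Z.carrier =>
          Quotient.mk (compSetoid (X.comp Y) Z) (Quotient.mk (compSetoid X Y) (a.1, t.1), t.2))
          ?_ a.2) ?_, ?_, ?_⟩, ?_, ?_⟩⟩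
  · rintro ⟨x, y⟩ ⟨x', y'⟩ ⟨h, h1, h2⟩
    exact Quotient.sound ⟨h, h1, congrArg (fun t => Quotient.mk (compSetoid Y Z) (t, a.2)) h2⟩
  · rintro ⟨q, z⟩ ⟨q', z'⟩ ⟨g, h1, h2⟩
    induction q using Quotient.inductionOn with | _ t
    replace h1 : q' = Quotient.mk (compSetoid X Y) (t.1, op g • t.2) := h1
    subst h1
    exact congrArg (fun s => Quotient.mk (compSetoid X (Y.comp Z)) (t.1, s))
      (Quotient.sound ⟨g, rfl, h2⟩)
  · rintro ⟨y, z⟩ ⟨y', z'⟩ ⟨g, h1, h2⟩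
    exact Quotient.sound ⟨g, congrArg (fun t => Quotient.mk (compSetoid X Y) (a.1, t)) h1, h2⟩
  · rintro ⟨x, q⟩ ⟨x', q'⟩ ⟨h, h1, h2⟩
    induction q' using Quotient.inductionOn with | _ t
    replace h2 : q = Quotient.mk (compSetoid Y Z) (h • t.1, t.2) := h2
    subst h2
    exact congrArg (fun s => Quotient.mk (compSetoid (X.comp Y) Z) (s, t.2))
      (Quotient.sound ⟨h, h1, rfl⟩)
  · rintro ⟨q, z⟩
    induction q using Quotient.inductionOn with | _ t
    rfl
  · rintro ⟨x, q⟩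
    induction q using Quotient.inductionOn with | _ t
    rfl
  all_goals
    rintro k ⟨q, z⟩
    induction q using Quotient.inductionOn with | _ t
    rfl

theorem IsoClass.id_comp [Finite H] [Finite G] (a : IsoClass p H G) :
    IsoClass.comp (Quotient.mk _ (Biset.id p H)) a = a := by
  induction a using Quotient.inductionOn with | _ X
  refine Quotient.sound ⟨⟨⟨Quotient.lift (fun a : H × X.carrier => a.1 • a.2) ?_,
    fun x => Quotient.mk (compSetoid (Biset.id p H) X) ((1 : H), x), ?_, ?_⟩, ?_, ?_⟩⟩
  · rintro ⟨(x : H), y⟩ ⟨(x' : H), y'⟩ ⟨h, h1, h2⟩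
    replace h1 : x' = x * h := h1
    replace h2 : y = h • y' := h2
    change x • y = x' • y'
    rw [h1, h2, mul_smul]
  · rintro ⟨(h : H), x⟩
    exact Quotient.sound ⟨h, (one_mul h).symm, rfl⟩
  · intro x
    exact one_smul H x
  · rintro k ⟨(h : H), x⟩
    exact mul_smul k h x
  · rintro k ⟨(h : H), x⟩
    exact smul_comm h k x

theorem IsoClass.comp_id [Finite H] [Finite G] (a : IsoClass p H G) :
    IsoClass.comp a (Quotient.mk _ (Biset.id p G)) = a := by
  induction a using Quotient.inductionOn with | _ X
  refine Quotient.sound ⟨⟨⟨Quotient.lift (fun a : X.carrier × G => op a.2 • a.1) ?_,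
    fun x => Quotient.mk (compSetoid X (Biset.id p G)) (x, (1 : G)), ?_, ?_⟩, ?_, ?_⟩⟩
  · rintro ⟨x, (y : G)⟩ ⟨x', (y' : G)⟩ ⟨h, h1, h2⟩
    replace h1 : x' = op h • x := h1
    replace h2 : y = h * y' := h2
    change op y • x = op y' • x'
    rw [h1, h2, op_mul, mul_smul]
  · rintro ⟨x, (g : G)⟩
    exact Quotient.sound
      ⟨g⁻¹, (inv_smul_smul (op g) x).symm, (inv_mul_cancel g).symm⟩
  · intro x
    exact one_smul Gᵐᵒᵖ x
  · rintro k ⟨x, (g : G)⟩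
    exact (smul_comm k (op g) x).symm
  · rintro k ⟨x, (g : G)⟩
    exact mul_smul k (op g) x

/-! ### The groups `B^Δ(H, G)` and the modules `R B^Δ(H, G)` -/

/-- The Grothendieck group of `p`-bifree `(H, G)`-bisets with respect to disjoint unions. -/
abbrev B (p : ℕ) (H G : Type u) [Group H] [Group G] : Type (u + 1) :=
  Algebra.GrothendieckAddGroup (IsoClass p H G)

/-- The scalar extension of `B^Δ(H, G)` to `R`. -/
abbrev RB (p : ℕ) (R : Type v) [CommRing R] (H G : Type u) [Group H] [Group G] :
    Type (max (u + 1) v) :=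
  R ⊗[ℤ] B p H G

/-- The class of a biset in `B^Δ(H, G)`. -/
def Biset.cls (X : Biset p H G) : B p H G :=
  Algebra.GrothendieckAddGroup.of (Quotient.mk _ X : IsoClass p H G)

/-- Two additive maps on `B^Δ(H, G)` agree if they agree on classes of bisets. -/
theorem B.hom_ext {A : Type*} [AddCommGroup A] {f g : B p H G →ₗ[ℤ] A}
    (h : ∀ X : Biset p H G, f X.cls = g X.cls) : f = g := by
  have : f.toAddMonoidHom = g.toAddMonoidHom := by
    apply Algebra.GrothendieckAddGroup.lift.symm.injective
    ext a
    induction a using Quotient.inductionOn with | _ X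
    exact h X
  ext x
  exact DFunLike.congr_fun this x

/-- The extension of an additive function on isomorphism classes of bisets to `B^Δ(H, G)`. -/
def B.lift {A : Type*} [AddCommGroup A] (f : IsoClass p H G →+ A) : B p H G →ₗ[ℤ] A :=
  (Algebra.GrothendieckAddGroup.lift f).toIntLinearMap

theorem B.lift_cls {A : Type*} [AddCommGroup A] (f : IsoClass p H G →+ A) (X : Biset p H G) :
    B.lift f X.cls = f (Quotient.mk _ X) :=
  DFunLike.congr_fun (Algebra.GrothendieckAddGroup.lift.symm_apply_apply f) (Quotient.mk _ X)

/-- The biadditive map `B^Δ(K, H) × B^Δ(H, G) → B^Δ(K, G)` induced by composition of bisets. -/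
def B.comp (p : ℕ) (K H G : Type u) [Group K] [Group H] [Group G] [Finite K] [Finite G] :
    B p K H →ₗ[ℤ] B p H G →ₗ[ℤ] B p K G :=
  B.lift
    { toFun := fun a => B.lift
        (Algebra.GrothendieckAddGroup.of.comp
          { toFun := fun b => IsoClass.comp a b
            map_zero' := IsoClass.comp_zero a
            map_add' := IsoClass.comp_add a })
      map_zero' := B.hom_ext fun X => by
        rw [B.lift_cls]
        exact (congrArg Algebra.GrothendieckAddGroup.of (IsoClass.zero_comp (K := K) (Quotient.mk _ X))).trans
          (map_zero Algebra.GrothendieckAddGroup.of)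
      map_add' := fun a a' => B.hom_ext fun X => by
        rw [LinearMap.add_apply, B.lift_cls, B.lift_cls, B.lift_cls]
        exact (congrArg Algebra.GrothendieckAddGroup.of (IsoClass.add_comp _ _ _)).trans
          (map_add Algebra.GrothendieckAddGroup.of _ _) }

theorem B.comp_cls [Finite K] [Finite G] (X : Biset p K H) (Y : Biset p H G) :
    B.comp p K H G X.cls Y.cls = (X.comp Y).cls := by
  simp only [B.comp, B.lift_cls]
  erw [B.lift_cls]
  rfl

/-- The `R`-bilinear extension of the composition of bisets. -/
def RB.comp (p : ℕ) (R : Type v) [CommRing R] (K H G : Type u) [Group K] [Group H] [Group G]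
    [Finite K] [Finite G] : RB p R K H →ₗ[R] RB p R H G →ₗ[R] RB p R K G :=
  LinearMap.liftBaseChange R (LinearMap.baseChangeHom ℤ R _ _ ∘ₗ B.comp p K H G)

theorem RB.comp_tmul {R : Type v} [CommRing R] [Finite K] [Finite G] (r s : R)
    (a : B p K H) (b : B p H G) :
    RB.comp p R K H G (r ⊗ₜ a) (s ⊗ₜ b) = (r * s) ⊗ₜ B.comp p K H G a b := by
  simp [RB.comp, TensorProduct.smul_tmul']

theorem B.induction {P : B p H G → Prop} (cls : ∀ X : Biset p H G, P X.cls) (zero : P 0)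
    (add : ∀ a b, P a → P b → P (a + b)) (smul : ∀ (n : ℤ) a, P a → P (n • a)) (a : B p H G) :
    P a := by
  have h : Submodule.span ℤ (Set.range (Biset.cls (p := p) (H := H) (G := G))) = ⊤ := by
    rw [← Submodule.ker_mkQ (Submodule.span ℤ _), LinearMap.ker_eq_top]
    refine B.hom_ext fun X => ?_
    simpa using Submodule.subset_span (Set.mem_range_self X)
  have ha : a ∈ Submodule.span ℤ (Set.range (Biset.cls (p := p) (H := H) (G := G))) := by simp [h]
  induction ha using Submodule.span_induction with
  | mem x hx => obtain ⟨X, rfl⟩ := hx; exact cls X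
  | zero => exact zero
  | add x y _ _ hx hy => exact add x y hx hy
  | smul n x _ hx => exact smul n x hx

theorem RB.induction {R : Type v} [CommRing R] {P : RB p R H G → Prop}
    (cls : ∀ X : Biset p H G, P (1 ⊗ₜ X.cls)) (zero : P 0)
    (add : ∀ a b, P a → P b → P (a + b)) (smul : ∀ (r : R) a, P a → P (r • a)) (a : RB p R H G) :
    P a := by
  induction a using TensorProduct.induction_on with
  | zero => exact zero
  | add x y hx hy => exact add x y hx hy
  | tmul r b =>
    suffices h : P (1 ⊗ₜ b) by
      simpa [TensorProduct.smul_tmul'] using smul r _ h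
    induction b using B.induction with
    | cls X => exact cls X
    | zero => simpa using zero
    | add a b ha hb => rw [TensorProduct.tmul_add]; exact add _ _ ha hb
    | smul n a ha =>
      have := smul (n : R) _ ha
      rwa [Int.cast_smul_eq_zsmul, ← TensorProduct.tmul_smul] at this

theorem RB.comp_cls {R : Type v} [CommRing R] [Finite K] [Finite G] (X : Biset p K H)
    (Y : Biset p H G) :
    RB.comp p R K H G (1 ⊗ₜ X.cls) (1 ⊗ₜ Y.cls) = 1 ⊗ₜ (X.comp Y).cls := by
  rw [RB.comp_tmul, B.comp_cls, one_mul]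

theorem RB.comp_assoc {R : Type v} [CommRing R] [Finite K] [Finite H] [Finite G] [Finite F]
    (a : RB p R K H) (b : RB p R H G) (c : RB p R G F) :
    RB.comp p R K G F (RB.comp p R K H G a b) c =
      RB.comp p R K H F a (RB.comp p R H G F b c) := by
  induction a using RB.induction with
  | zero => simp
  | add a a' h h' => simp [h, h']
  | smul r a h => simp [h]
  | cls X =>
    induction b using RB.induction with
    | zero => simp
    | add a a' h h' => simp [h, h']
    | smul r a h => simp [h]
    | cls Y =>
      induction c using RB.induction with
      | zero => simp
      | add a a' h h' => simp [h, h']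
      | smul r a h => simp [h]
      | cls Z =>
        simp only [RB.comp_cls]
        exact congrArg (fun t => (1 : R) ⊗ₜ[ℤ] Algebra.GrothendieckAddGroup.of t)
          (IsoClass.comp_assoc (Quotient.mk _ X) (Quotient.mk _ Y) (Quotient.mk _ Z))

theorem RB.id_comp {R : Type v} [CommRing R] [Finite H] [Finite G] (a : RB p R H G) :
    RB.comp p R H H G (1 ⊗ₜ (Biset.id p H).cls) a = a := by
  induction a using RB.induction with
  | zero => simp
  | add a a' h h' => simp [h, h']
  | smul r a h => simp [h]
  | cls X =>
    rw [RB.comp_cls]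
    exact congrArg (fun t => (1 : R) ⊗ₜ[ℤ] Algebra.GrothendieckAddGroup.of t)
      (IsoClass.id_comp (Quotient.mk _ X))

theorem RB.comp_id {R : Type v} [CommRing R] [Finite H] [Finite G] (a : RB p R H G) :
    RB.comp p R H G G a (1 ⊗ₜ (Biset.id p G).cls) = a := by
  induction a using RB.induction with
  | zero => simp
  | add a a' h h' => simp [h, h']
  | smul r a h => simp [h]
  | cls X =>
    rw [RB.comp_cls]
    exact congrArg (fun t => (1 : R) ⊗ₜ[ℤ] Algebra.GrothendieckAddGroup.of t)
      (IsoClass.comp_id (Quotient.mk _ X))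

end Bisets

/-! ### The `p`-bifree biset category -/

/-- The category `R C^Δ`: the objects are the finite groups. -/
structure Cat (p : ℕ) (R : Type v) [CommRing R] where
  carrier : Type u
  [group : Group carrier]
  [finite : Finite carrier]

attribute [instance] Cat.group Cat.finite

section Category

variable {p : ℕ} {R : Type v} [CommRing R]

/-- The morphisms `G ⟶ H` are the elements of `R B^Δ(H, G)`; composition is the bilinear extension
of the composition of bisets. -/
instance : Category.{max (u + 1) v} (Cat.{u, v} p R) where
  Hom G H := RB p R H.carrier G.carrier
  id G := 1 ⊗ₜ (Biset.id p G.carrier).cls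
  comp {_ _ _} f g := RB.comp p R _ _ _ g f
  id_comp f := RB.comp_id f
  comp_id f := RB.id_comp f
  assoc f g h := (RB.comp_assoc h g f).symm

instance : Preadditive (Cat.{u, v} p R) where
  homGroup G H := inferInstanceAs (AddCommGroup (RB p R H.carrier G.carrier))
  add_comp _ _ _ f f' g := LinearMap.map_add (RB.comp p R _ _ _ g) f f'
  comp_add _ _ _ f g g' := LinearMap.map_add₂ (RB.comp p R _ _ _) g g' f

instance : Linear R (Cat.{u, v} p R) where
  homModule G H := inferInstanceAs (Module R (RB p R H.carrier G.carrier))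
  smul_comp _ _ _ r f g := LinearMap.map_smul (RB.comp p R _ _ _ g) r f
  comp_smul _ _ _ f r g := LinearMap.map_smul₂ (RB.comp p R _ _ _) r g f

end Category

/-! ### The functors `L_{G,V}`, `J_{G,V}` and `S_{G,V}` -/

section Simple

variable {p : ℕ} {R : Type v} [CommRing R] {G : Cat.{u, v} p R} {V : Type w} [AddCommGroup V]
  [Module R V] (ρ : End G →ₐ[R] Module.End R V)

/-- The relations `(x · e) ⊗ v = x ⊗ (e · v)`, for `e` in the endomorphism algebra of `G`,
that cut out the tensor product over this algebra from the tensor product over `R`. -/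
def balanced (H : Cat.{u, v} p R) : Submodule R ((G ⟶ H) ⊗[R] V) :=
  Submodule.span R
    {t | ∃ (x : G ⟶ H) (e : End G) (v : V), t = (e.asHom ≫ x) ⊗ₜ[R] v - x ⊗ₜ[R] ρ e v}

/-- `L_{G,V}(H) = R B^Δ(H, G) ⊗_{E_G} V`, where `E_G = R B^Δ(G, G)` and `V` is the `E_G`-module
given by `ρ`. -/
abbrev L (H : Cat.{u, v} p R) : Type (max (u + 1) v w) :=
  ((G ⟶ H) ⊗[R] V) ⧸ balanced ρ H

/-- The action of a morphism on `L_{G,V}`, `x ⊗ v ↦ (α · x) ⊗ v`. -/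
def L.map {H H' : Cat.{u, v} p R} (α : H ⟶ H') : L ρ H →ₗ[R] L ρ H' :=
  Submodule.mapQ _ _ ((Linear.rightComp R G α).rTensor V) (by
    rw [balanced, Submodule.span_le]
    rintro _ ⟨x, e, v, rfl⟩
    refine Submodule.subset_span ⟨x ≫ α, e, v, ?_⟩
    simp)

/-- The map `L_{G,V}(H) → V`, `x ⊗ v ↦ (y · x) v` for `y ∈ R B^Δ(G, H)`. -/
def L.eval {H : Cat.{u, v} p R} (y : H ⟶ G) : L ρ H →ₗ[R] V :=
  Submodule.liftQ _
    (TensorProduct.lift (ρ.toLinearMap ∘ₗ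
      (show (G ⟶ H) →ₗ[R] End G from Linear.rightComp R G y))) (by
    rw [balanced, Submodule.span_le]
    rintro _ ⟨x, e, v, rfl⟩
    have : ρ (End.of ((e.asHom ≫ x) ≫ y)) v = ρ (End.of (x ≫ y)) (ρ e v) := by
      rw [Category.assoc, ← Module.End.mul_apply, ← map_mul]
      rfl
    rw [SetLike.mem_coe, LinearMap.mem_ker, map_sub, sub_eq_zero]
    exact this)

/-- `J_{G,V}(H)`: the elements `∑ xᵢ ⊗ vᵢ` with `∑ (y · xᵢ) vᵢ = 0` for all `y ∈ R B^Δ(G, H)`. -/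
def J (H : Cat.{u, v} p R) : Submodule R (L ρ H) :=
  ⨅ y : H ⟶ G, LinearMap.ker (L.eval ρ y)

theorem L.eval_map {H H' : Cat.{u, v} p R} (α : H ⟶ H') (y : H' ⟶ G) (t : L ρ H) :
    L.eval ρ y (L.map ρ α t) = L.eval ρ (α ≫ y) t := by
  obtain ⟨t, rfl⟩ := Submodule.mkQ_surjective _ t
  induction t using TensorProduct.induction_on with
  | zero => simp
  | add a b ha hb => simp only [map_add, ha, hb]
  | tmul x v => exact congrArg (fun t => ρ (End.of t) v) (Category.assoc x α y)

/-- The action of a morphism on `L_{G,V} / J_{G,V}`. -/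
def S.mapHom {H H' : Cat.{u, v} p R} (α : H ⟶ H') : (L ρ H ⧸ J ρ H) →ₗ[R] (L ρ H' ⧸ J ρ H') :=
  Submodule.mapQ _ _ (L.map ρ α) (by
    intro t ht
    simp only [J, Submodule.mem_comap, Submodule.mem_iInf, LinearMap.mem_ker] at ht ⊢
    intro y
    rw [L.eval_map, ht])

/-- The class of `x ⊗ v` in `L_{G,V}(H) / J_{G,V}(H)`. -/
def S.mk {H : Cat.{u, v} p R} (x : G ⟶ H) (v : V) : L ρ H ⧸ J ρ H :=
  Submodule.Quotient.mk (Submodule.Quotient.mk (x ⊗ₜ[R] v))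

theorem S.mapHom_mk {H H' : Cat.{u, v} p R} (α : H ⟶ H') (x : G ⟶ H) (v : V) :
    S.mapHom ρ α (S.mk ρ x v) = S.mk ρ (x ≫ α) v := rfl

theorem S.hom_ext {H : Cat.{u, v} p R} {M : Type*} [AddCommGroup M] [Module R M]
    {f g : (L ρ H ⧸ J ρ H) →ₗ[R] M} (h : ∀ x v, f (S.mk ρ x v) = g (S.mk ρ x v)) : f = g := by
  refine Submodule.linearMap_qext _ (Submodule.linearMap_qext _ (TensorProduct.ext' h))

/-- The `p`-bifree biset functor `S_{G,V} = L_{G,V} / J_{G,V}`. -/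
def S : Cat.{u, v} p R ⥤ ModuleCat.{max (u + 1) v w} R where
  obj H := ModuleCat.of R (L ρ H ⧸ J ρ H)
  map α := ModuleCat.ofHom (S.mapHom ρ α)
  map_id H := ModuleCat.hom_ext (S.hom_ext ρ fun x v => by
    simp [S.mapHom_mk])
  map_comp α β := ModuleCat.hom_ext (S.hom_ext ρ fun x v => by
    simp [S.mapHom_mk])

instance : (S ρ).Additive where
  map_add {H H' α β} := ModuleCat.hom_ext (S.hom_ext ρ fun x v => by
    change S.mapHom ρ (α + β) _ = S.mapHom ρ α _ + S.mapHom ρ β _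
    simp only [S.mapHom_mk, Preadditive.comp_add]
    simp [S.mk, TensorProduct.add_tmul])

instance : (S ρ).Linear R where
  map_smul {H H'} α r := ModuleCat.hom_ext (S.hom_ext ρ fun x v => by
    change S.mapHom ρ (r • α) _ = r • S.mapHom ρ α _
    simp only [S.mapHom_mk, Linear.comp_smul]
    simp [S.mk, ← TensorProduct.smul_tmul'])

end Simple

/-! ### The simple functor attached to the trivial group and the trivial module -/

section Trivial

/-- The trivial group. -/
def Triv : Type u := PUnit

instance : Group Triv.{u} := inferInstanceAs (Group PUnit)

instance : Unique Triv.{u} := inferInstanceAs (Unique PUnit)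

variable (p : ℕ) (R : Type v) [CommRing R]

/-- The trivial group as an object of the `p`-bifree biset category. -/
abbrev one : Cat.{u, v} p R where
  carrier := Triv.{u}

/-- The number of elements of a `(1, 1)`-biset, as an additive function on isomorphism classes. -/
def cardHom : IsoClass p Triv.{u} Triv.{u} →+ R where
  toFun := Quotient.lift (fun X => (Nat.card X.carrier : R)) fun _ _ ⟨e⟩ => by
    rw [Nat.card_congr e.toEquiv]
  map_zero' := by
    change ((Nat.card PEmpty : ℕ) : R) = 0
    simp
  map_add' a b := by
    induction a using Quotient.inductionOn with | _ X
    induction b using Quotient.inductionOn with | _ Y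
    change ((Nat.card (X.carrier ⊕ Y.carrier) : ℕ) : R) = Nat.card X.carrier + Nat.card Y.carrier
    rw [Nat.card_sum, Nat.cast_add]

/-- The linear extension of `[X] ↦ |X|` to `R B^Δ(1, 1)`. -/
def augLinear : RB p R Triv.{u} Triv.{u} →ₗ[R] R :=
  LinearMap.liftBaseChange R (B.lift (cardHom p R))

theorem augLinear_cls (X : Biset p Triv.{u} Triv.{u}) :
    augLinear p R (1 ⊗ₜ X.cls) = Nat.card X.carrier := by
  rw [augLinear, LinearMap.liftBaseChange_tmul, one_smul, B.lift_cls]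
  rfl

theorem card_comp_triv (X Y : Biset p Triv.{u} Triv.{u}) :
    Nat.card (X.comp Y).carrier = Nat.card X.carrier * Nat.card Y.carrier := by
  rw [← Nat.card_prod]
  refine (Nat.card_congr (Equiv.ofBijective (Quotient.mk (compSetoid X Y)) ⟨?_, ?_⟩)).symm
  · rintro ⟨x, y⟩ ⟨x', y'⟩ h
    obtain ⟨h, h1, h2⟩ := Quotient.exact h
    replace h1 : x' = op h • x := h1
    replace h2 : y = h • y' := h2
    rw [Subsingleton.elim h 1] at h1 h2
    rw [op_one, one_smul] at h1
    rw [one_smul] at h2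
    rw [h1, h2]
  · exact Quotient.mk_surjective

theorem augLinear_comp (a b : RB p R Triv.{u} Triv.{u}) :
    augLinear p R (RB.comp p R _ _ _ a b) = augLinear p R a * augLinear p R b := by
  induction a using RB.induction with
  | zero => simp
  | add a a' h h' => simp [h, h', add_mul]
  | smul r a h => simp [h, mul_assoc]
  | cls X =>
    induction b using RB.induction with
    | zero => simp
    | add a a' h h' => simp [h, h', mul_add]
    | smul r a h => simp [h, mul_left_comm]
    | cls Y => rw [RB.comp_cls, augLinear_cls, augLinear_cls, augLinear_cls, card_comp_triv,
        Nat.cast_mul]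

/-- The canonical algebra homomorphism `E_1 = R B^Δ(1, 1) → R`. A `(1, 1)`-biset `X` is a disjoint
union of `|X|` copies of the identity biset, so `[X] = |X| · id` is sent to `|X|`. -/
def aug : End (one.{u, v} p R) →ₐ[R] R :=
  AlgHom.ofLinearMap (augLinear p R)
    ((augLinear_cls p R (Biset.id p Triv.{u})).trans (by simp [Biset.id]))
    (augLinear_comp p R)

/-- The trivial module `R` of `R Out(1) = R`, as a module for `E_1 = R B^Δ(1, 1)`. There are no
groups of order less than `1`, so the essential algebra of the trivial group is `E_1` itself, and
the only `R`-linear unital action of `E_1 = R · id` on `R` is the one by scalars. -/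
def trivialModule : End (one.{u, v} p R) →ₐ[R] Module.End R R :=
  (Algebra.lmul R R).comp (aug p R)

/-- The functor `S_{1,R}`. -/
abbrev STrivial : Cat.{u, v} p R ⥤ ModuleCat.{max (u + 1) v} R :=
  S (trivialModule.{u, v} p R)

end Trivial

/-! ### Conjugacy classes of cyclic `p'`-subgroups -/

/-- The cyclic `p'`-subgroups of a group. -/
abbrev CyclicPPrimeSubgroup (p : ℕ) (G : Type u) [Group G] : Type u :=
  {C : Subgroup G // IsCyclic C ∧ IsPPrimeGroup p C}

/-- Conjugacy of cyclic `p'`-subgroups. -/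
def conjSetoid (p : ℕ) (G : Type u) [Group G] : Setoid (CyclicPPrimeSubgroup p G) where
  r C D := ∃ g : G, D.1 = C.1.map (MulAut.conj g).toMonoidHom
  iseqv :=
    { refl := fun C => ⟨1, by ext; simp⟩
      symm := by
        rintro C D ⟨g, h⟩
        refine ⟨g⁻¹, ?_⟩
        rw [h, Subgroup.map_map]
        ext; simp [MulAut.conj, mul_assoc]
      trans := by
        rintro C D E ⟨g, h⟩ ⟨k, h'⟩
        refine ⟨k * g, ?_⟩
        rw [h', h, Subgroup.map_map]
        ext; simp [mul_assoc] }

end PBifree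
end

/-!
The mark of a biset at a subgroup of `H × G` is its number of fixed points there. For a
`(1, G)`-biset `Y` and a `(G, 1)`-biset `X`, Burnside's lemma says that `|G| · |Y ×_G X|` is the sum
over `g ∈ G` of the products of the marks of `Y` and `X` at `⟨g⟩`. A product vanishes unless `⟨g⟩`
is a `p'`-group, and it depends only on the conjugacy class of `⟨g⟩`. So the pairing whose kernel
is `J` is diagonal in the marks at the classes of cyclic `p'`-subgroups `C`, where the weight of the
class of `C` is the proportion of elements of `G` that generate a conjugate of `C`, that is
`|G : N_G(C)| φ(|C|) / |G|`.

The marks of `G / D` at `C` vanish unless `C` is contained in a conjugate of `D`, so this table is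
triangular, with diagonal entries `|N_G(D) : D|`, which divide `|G|`. Hence, once `|G|` is
invertible, every vector of marks is attained on both sides, and `L / J` has the classes of nonzero
weight as coordinates.
-/

noncomputable section

namespace PBifree

section LinearAlgebra

theorem span_range_eq_top_of_triangular {𝕂 ι α : Type*} [DivisionRing 𝕂] [Finite ι] [Preorder α]
    [WellFoundedLT α] (rank : ι → α) (f : ι → ι → 𝕂) (hdiag : ∀ i, f i i ≠ 0)
    (hlt : ∀ i j, j ≠ i → f i j ≠ 0 → rank j < rank i) :
    Submodule.span 𝕂 (Set.range f) = ⊤ := by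
  classical
  have := Fintype.ofFinite ι
  set W := Submodule.span 𝕂 (Set.range f)
  have single_mem (a : α) : ∀ i, rank i = a → (Pi.single i 1 : ι → 𝕂) ∈ W := by
    induction a using WellFoundedLT.induction with | _ a ih
    rintro i rfl
    have hrest : ∑ j ∈ Finset.univ.erase i, f i j • (Pi.single j 1 : ι → 𝕂) ∈ W := by
      refine W.sum_mem fun j hj => ?_
      by_cases hij : f i j = 0
      · simp [hij]
      · exact W.smul_mem _ (ih _ (hlt i j (Finset.ne_of_mem_erase hj) hij) j rfl)
    have hsum : f i i • Pi.single i 1 + ∑ j ∈ Finset.univ.erase i, f i j • Pi.single j 1 = f i := by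
      rw [Finset.add_sum_erase _ (fun j => f i j • (Pi.single j 1 : ι → 𝕂)) (Finset.mem_univ i)]
      exact (pi_eq_sum_univ' (f i)).symm.trans (by simp)
    have hi : f i ∈ W := Submodule.subset_span ⟨i, rfl⟩
    rw [← hsum, W.add_mem_iff_left hrest] at hi
    exact (W.smul_mem_iff (hdiag i)).mp hi
  rw [eq_top_iff, ← (Pi.basisFun 𝕂 ι).span_eq, Submodule.span_le]
  rintro _ ⟨i, rfl⟩
  simpa using single_mem _ i rfl

theorem nonempty_quotient_iInf_ker_equiv {R M L N Q : Type*} [CommRing R] [NoZeroDivisors R]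
    [AddCommGroup M] [Module R M] [AddCommGroup L] [Module R L] [Fintype Q] {π : M →ₗ[R] L}
    (hπ : Function.Surjective π) {m : M →ₗ[R] Q → R} (hm : Function.Surjective m)
    {n : N → Q → R} (hn : Function.Surjective n) (w : Q → R) {e : N → L →ₗ[R] R}
    (he : ∀ y x, e y (π x) = ∑ q, w q * (n y q * m x q)) :
    Nonempty ((L ⧸ ⨅ y, LinearMap.ker (e y)) ≃ₗ[R] ({q // w q ≠ 0} → R)) := by
  classical
  let φ := (⨅ y, LinearMap.ker (e y)).mkQ ∘ₗ π
  let μ := LinearMap.funLeft R R (Subtype.val : {q // w q ≠ 0} → Q) ∘ₗ m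
  have hφ : Function.Surjective φ := (Submodule.mkQ_surjective _).comp hπ
  have hμ : Function.Surjective μ :=
    (LinearMap.funLeft_surjective_of_injective R R _ Subtype.val_injective).comp hm
  have hker : LinearMap.ker φ = LinearMap.ker μ := by
    ext x
    have hxφ : x ∈ LinearMap.ker φ ↔ ∀ y, e y (π x) = 0 := by simp [φ, Submodule.mem_iInf]
    have hxμ : x ∈ LinearMap.ker μ ↔ ∀ q, w q ≠ 0 → m x q = 0 := by
      simp [μ, funext_iff, LinearMap.funLeft_apply]
    rw [hxφ, hxμ]
    refine ⟨fun h q hq => ?_, fun h y => ?_⟩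
    · obtain ⟨y, hy⟩ := hn (Pi.single q 1)
      have hyx : e y (π x) = w q * m x q := by
        rw [he, hy, Finset.sum_eq_single q (fun r _ hr => by simp [hr]) (by simp)]
        simp
      exact (mul_eq_zero.mp (hyx.symm.trans (h y))).resolve_left hq
    · rw [he]
      refine Finset.sum_eq_zero fun q _ => ?_
      by_cases hq : w q = 0
      · rw [hq, zero_mul]
      · rw [h q hq, mul_zero, mul_zero]
  exact ⟨(φ.quotKerEquivOfSurjective hφ).symm ≪≫ₗ Submodule.quotEquivOfEq _ _ hker ≪≫ₗ
    μ.quotKerEquivOfSurjective hμ⟩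

end LinearAlgebra

section Groups

open scoped Pointwise

variable {G : Type*} [Group G]

theorem fixedPoints_zpowers {α : Type*} [MulAction G α] (g : G) :
    MulAction.fixedPoints (Subgroup.zpowers g) α = MulAction.fixedBy α g :=
  Set.ext fun x => Subtype.forall.trans (Subgroup.zpowers_le (H := MulAction.stabilizer G x))

theorem card_zpowers_eq_totient [Finite G] (C : Subgroup G) [IsCyclic C] :
    Nat.card {g : G // Subgroup.zpowers g = C} = (Nat.card C).totient := by
  classical
  have := Fintype.ofFinite C
  have zpowers_eq_iff (c : C) : Subgroup.zpowers (c : G) = C ↔ orderOf c = Nat.card C := by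
    rw [← Subgroup.orderOf_coe, ← Nat.card_zpowers]
    exact ⟨fun h => by rw [h],
      fun h => Subgroup.eq_of_le_of_card_ge (Subgroup.zpowers_le.mpr c.2) h.ge⟩
  rw [← IsCyclic.card_orderOf_eq_totient Nat.card_eq_fintype_card.dvd, ← Fintype.card_subtype,
    ← Nat.card_eq_fintype_card]
  exact Nat.card_congr ((Equiv.subtypeSubtypeEquivSubtype fun {g} (hg : Subgroup.zpowers g = C) =>
    hg ▸ Subgroup.mem_zpowers g).symm.trans (Equiv.subtypeEquivRight zpowers_eq_iff))

theorem card_conjugates_dvd (C : Subgroup G) :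
    Nat.card (Set.range fun g : G => C.map (MulAut.conj g).toMonoidHom) ∣ Nat.card G := by
  let _ : MulAction G (Subgroup G) := MulAction.compHom _ (MulAut.conj (G := G))
  exact (Nat.card_congr (MulAction.orbitEquivQuotientStabilizer G C)).dvd.trans
    (Subgroup.card_quotient_dvd_card _)

theorem card_zpowers_mem_eq_mul_totient [Finite G] (S : Set (Subgroup G)) {n : ℕ}
    (hS : ∀ C ∈ S, IsCyclic C ∧ Nat.card C = n) :
    Nat.card {g : G // Subgroup.zpowers g ∈ S} = Nat.card S * n.totient := by
  have : Fintype S := Fintype.ofFinite S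
  have e : {g : G // Subgroup.zpowers g ∈ S} ≃ Σ C : S, {g : G // Subgroup.zpowers g = C} :=
    (Equiv.sigmaSubtypeFiberEquivSubtype Subgroup.zpowers fun _ => Iff.rfl).symm
  have card_fiber (C : S) : Nat.card {g : G // Subgroup.zpowers g = C} = n.totient := by
    obtain ⟨hcyc, hcard⟩ := hS C C.2
    rw [card_zpowers_eq_totient, hcard]
  rw [Nat.card_congr e, Nat.card_sigma, Finset.sum_congr rfl fun C _ => card_fiber C]
  simp

theorem card_fixedPoints_quotient_self_dvd [Finite G] (D : Subgroup G) :
    Nat.card (MulAction.fixedPoints D (G ⧸ D)) ∣ Nat.card G :=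
  (Nat.card_congr (Sylow.fixedPointsMulLeftCosetsEquivQuotient D)).dvd.trans
    ((Subgroup.card_quotient_dvd_card _).trans (Subgroup.card_subgroup_dvd_card _))

theorem stabilizer_quotient_mk (D : Subgroup G) (g : G) :
    MulAction.stabilizer G (g : G ⧸ D) = D.map (MulAut.conj g).toMonoidHom := by
  have h := MulAction.stabilizer_smul_eq_stabilizer_map_conj g ((1 : G) : G ⧸ D)
  rwa [MulAction.stabilizer_quotient, MulAction.Quotient.smul_coe, smul_eq_mul, mul_one] at h

theorem exists_le_map_conj_of_nonempty_fixedPoints {C D : Subgroup G}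
    (h : (MulAction.fixedPoints C (G ⧸ D)).Nonempty) :
    ∃ g : G, C ≤ D.map (MulAut.conj g).toMonoidHom := by
  obtain ⟨x, hx⟩ := h
  obtain ⟨g, rfl⟩ := QuotientGroup.mk_surjective x
  exact ⟨g, stabilizer_quotient_mk D g ▸ fun c hc => hx ⟨c, hc⟩⟩

theorem mem_fixedPoints_map {A α : Type*} [Group A] [MulAction G α] {f : A →* G} {C : Subgroup A}
    {x : α} : x ∈ MulAction.fixedPoints (C.map f) α ↔ ∀ c : C, f c • x = x := by
  simp only [MulAction.mem_fixedPoints, Subtype.forall, Subgroup.mk_smul, Subgroup.mem_map,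
    forall_exists_index, and_imp, forall_apply_eq_imp_iff₂]

theorem card_fixedPoints_map_conj {α : Type*} [MulAction G α] (g : G) (C : Subgroup G) :
    Nat.card (MulAction.fixedPoints (C.map (MulAut.conj g).toMonoidHom) α) =
      Nat.card (MulAction.fixedPoints C α) := by
  refine (Nat.card_congr ((MulAction.toPerm g).subtypeEquiv fun x =>
    Iff.trans (forall_congr' fun c => ?_) mem_fixedPoints_map.symm)).symm
  simp [mul_smul, Subgroup.smul_def]

end Groups

section PPrime

variable {p : ℕ} {A : Type*} [Group A]

theorem isPPrimeGroup_of_subsingleton [Subsingleton A] : IsPPrimeGroup p A := by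
  rw [IsPPrimeGroup, Nat.card_unique]
  exact Nat.coprime_one_left p

theorem IsPPrimeGroup.of_le {C D : Subgroup A} (hD : IsPPrimeGroup p D) (h : C ≤ D) :
    IsPPrimeGroup p C :=
  hD.coprime_dvd_left (Subgroup.card_dvd_of_le h)

theorem IsPPrimeGroup.map_conj {D : Subgroup A} (hD : IsPPrimeGroup p D) (a : A) :
    IsPPrimeGroup p (D.map (MulAut.conj a).toMonoidHom) := by
  rwa [IsPPrimeGroup, Subgroup.card_map_of_injective (MulAut.conj a).injective]

theorem IsPPrimeGroup.stabilizer_quotient {D : Subgroup A} (hD : IsPPrimeGroup p D) (x : A ⧸ D) :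
    IsPPrimeGroup p (MulAction.stabilizer A x) := by
  obtain ⟨a, rfl⟩ := QuotientGroup.mk_surjective x
  rw [stabilizer_quotient_mk]
  exact hD.map_conj a

end PPrime

section Marks

variable {p : ℕ} {K H G : Type u} [Group K] [Group H] [Group G]

/-- An `(H, G)`-biset as a left `H × G`-set, with `(h, g)` acting by `x ↦ h x g⁻¹`. -/
instance Biset.prodAction (X : Biset p H G) : MulAction (H × G) X.carrier where
  smul a x := a.1 • op a.2⁻¹ • x
  one_smul x := by
    change (1 : H) • op (1 : G)⁻¹ • x = x
    simp
  mul_smul a b x := by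
    change (a.1 * b.1) • op (a.2 * b.2)⁻¹ • x = a.1 • op a.2⁻¹ • b.1 • op b.2⁻¹ • x
    rw [mul_inv_rev, op_mul, mul_smul, mul_smul, smul_comm b.1 (op a.2⁻¹)]

theorem Biset.prod_smul_def (X : Biset p H G) (a : H × G) (x : X.carrier) :
    a • x = a.1 • op a.2⁻¹ • x := rfl

theorem Biset.inl_smul (X : Biset p H G) (h : H) (x : X.carrier) :
    MonoidHom.inl H G h • x = h • x := by
  simp [prod_smul_def]

theorem Biset.inr_smul (X : Biset p H G) (g : G) (x : X.carrier) :
    MonoidHom.inr H G g • x = op g⁻¹ • x := by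
  simp [prod_smul_def]

theorem BisetIso.map_prod_smul {X Y : Biset p H G} (e : BisetIso X Y) (a : H × G)
    (x : X.carrier) : e.toEquiv (a • x) = a • e.toEquiv x :=
  (e.map_left _ _).trans (congrArg _ (e.map_right _ _))

/-- The mark of a biset at a subgroup `D` of `H × G`: the number of its fixed points under `D`,
for the left action `Biset.prodAction`. -/
def Biset.mark (X : Biset p H G) (D : Subgroup (H × G)) : ℕ :=
  Nat.card (MulAction.fixedPoints D X.carrier)

theorem BisetIso.mark_eq {X Y : Biset p H G} (e : BisetIso X Y) (D : Subgroup (H × G)) :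
    X.mark D = Y.mark D :=
  Nat.card_congr (e.toEquiv.subtypeEquiv fun x => forall_congr' fun d =>
    e.toEquiv.injective.eq_iff.symm.trans (Eq.congr_left (e.map_prod_smul d x)))

theorem Biset.mark_empty (D : Subgroup (H × G)) : (Biset.empty p H G).mark D = 0 :=
  have : IsEmpty (MulAction.fixedPoints D (Biset.empty p H G).carrier) :=
    ⟨fun x => PEmpty.elim x.1⟩
  Nat.card_of_isEmpty

theorem Biset.mark_sum (X Y : Biset p H G) (D : Subgroup (H × G)) :
    (X.sum Y).mark D = X.mark D + Y.mark D := by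
  rw [mark, mark, mark, ← Nat.card_sum]
  exact Nat.card_congr (Equiv.subtypeSum.trans (Equiv.sumCongr
    (Equiv.subtypeEquivRight fun _ => forall_congr' fun _ => Sum.inl_injective.eq_iff)
    (Equiv.subtypeEquivRight fun _ => forall_congr' fun _ => Sum.inr_injective.eq_iff)))

theorem Biset.mark_map_zpowers {A : Type*} [Group A] (X : Biset p H G) (f : A →* H × G) (a : A) :
    X.mark ((Subgroup.zpowers a).map f) = Nat.card (MulAction.fixedBy X.carrier (f a)) := by
  rw [mark, MonoidHom.map_zpowers, fixedPoints_zpowers]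

theorem Biset.mark_map_inl_eq_zero (X : Biset p H G) {C : Subgroup H} (hC : ¬ IsPPrimeGroup p C) :
    X.mark (C.map (MonoidHom.inl H G)) = 0 := by
  have : IsEmpty (MulAction.fixedPoints (C.map (MonoidHom.inl H G)) X.carrier) :=
    ⟨fun x => hC ((X.left_stabilizer x.1).of_le fun c hc =>
      (X.inl_smul c x.1).symm.trans (x.2 ⟨_, Subgroup.mem_map_of_mem _ hc⟩))⟩
  exact Nat.card_of_isEmpty

theorem Biset.card_comp_mul_card [Finite K] [Finite G] [Fintype H] (X : Biset p K H)
    (Y : Biset p H G) :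
    Nat.card (X.comp Y).carrier * Nat.card H =
      ∑ h : H, Nat.card (MulAction.fixedBy X.carrier (MonoidHom.inr K H h)) *
        Nat.card (MulAction.fixedBy Y.carrier (MonoidHom.inl H G h)) := by
  classical
  let _ : MulAction H X.carrier := MulAction.compHom X.carrier (MonoidHom.inr K H)
  have smul_left (h : H) (x : X.carrier) : h • x = MonoidHom.inr K H h • x := rfl
  have card_orbits : Nat.card (X.comp Y).carrier =
      Nat.card (Quotient (MulAction.orbitRel H (X.carrier × Y.carrier))) := by
    refine Nat.card_congr (Quotient.congr (Equiv.refl _) fun a b => exists_congr fun h => ?_)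
    change _ ↔ h • b = a
    rw [Prod.ext_iff, Prod.smul_fst, Prod.smul_snd, smul_left, X.inr_smul, MulOpposite.op_inv,
      inv_smul_eq_iff, eq_comm (a := a.2)]
  have card_fixedBy (h : H) : Nat.card (MulAction.fixedBy (X.carrier × Y.carrier) h) =
      Nat.card (MulAction.fixedBy X.carrier (MonoidHom.inr K H h)) *
        Nat.card (MulAction.fixedBy Y.carrier (MonoidHom.inl H G h)) := by
    rw [← Nat.card_prod]
    refine Nat.card_congr ((Equiv.subtypeEquivRight fun a => ?_).trans
      (Equiv.subtypeProdEquivProd (p := fun x => x ∈ MulAction.fixedBy X.carrier _)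
        (q := fun y => y ∈ MulAction.fixedBy Y.carrier _)))
    simp only [MulAction.mem_fixedBy, Prod.ext_iff, Prod.smul_fst, Prod.smul_snd, smul_left,
      Y.inl_smul]
  have := Fintype.ofFinite X.carrier
  have := Fintype.ofFinite Y.carrier
  have burnside := MulAction.sum_card_fixedBy_eq_card_orbits_mul_card_group H
    (X.carrier × Y.carrier)
  simp only [← Nat.card_eq_fintype_card, card_fixedBy, ← card_orbits] at burnside
  exact burnside.symm

variable (R : Type v) [CommRing R]

/-- `Biset.mark` as an additive function on isomorphism classes. -/
def markHom (D : Subgroup (H × G)) : IsoClass p H G →+ R where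
  toFun := Quotient.lift (fun X => (X.mark D : R)) fun _ _ ⟨e⟩ => by rw [e.mark_eq]
  map_zero' := (congrArg Nat.cast (Biset.mark_empty D)).trans Nat.cast_zero
  map_add' a b := Quotient.inductionOn₂ a b fun X Y =>
    (congrArg Nat.cast (X.mark_sum Y D)).trans (Nat.cast_add _ _)

/-- The linear extension of `Biset.mark` to `R B^Δ(H, G)`. -/
def RB.mark (D : Subgroup (H × G)) : RB p R H G →ₗ[R] R :=
  LinearMap.liftBaseChange R (B.lift (markHom R D))

theorem RB.mark_cls (D : Subgroup (H × G)) (X : Biset p H G) :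
    RB.mark R D (1 ⊗ₜ X.cls) = X.mark D := by
  rw [mark, LinearMap.liftBaseChange_tmul, one_smul, B.lift_cls]
  rfl

variable {R}

theorem RB.hom_ext {M : Type*} [AddCommGroup M] [Module R M] {f g : RB p R H G →ₗ[R] M}
    (h : ∀ X : Biset p H G, f (1 ⊗ₜ X.cls) = g (1 ⊗ₜ X.cls)) : f = g :=
  TensorProduct.AlgebraTensorModule.curry_injective (LinearMap.ext_ring (B.hom_ext h))

theorem RB.mark_map_conj (a : H × G) (D : Subgroup (H × G)) :
    RB.mark (p := p) R (D.map (MulAut.conj a).toMonoidHom) = RB.mark R D :=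
  RB.hom_ext fun X => by rw [mark_cls, mark_cls, Biset.mark, card_fixedPoints_map_conj, Biset.mark]

end Marks

section GSets

variable {p : ℕ} {G : Type u} [Group G]

/-- A `G`-set with `p'`-stabilizers as a `(G, 1)`-biset. -/
def Biset.ofLeft (Ω : Type u) [Finite Ω] [MulAction G Ω]
    (h : ∀ x : Ω, IsPPrimeGroup p (MulAction.stabilizer G x)) : Biset p G Triv.{u} where
  carrier := Ω
  right := { smul := fun _ x => x, one_smul := fun _ => rfl, mul_smul := fun _ _ _ => rfl }
  comm := @SMulCommClass.mk _ _ _ _ ⟨fun _ x => x⟩ fun _ _ _ => rfl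
  left_stabilizer := h
  right_stabilizer _ := isPPrimeGroup_of_subsingleton

/-- A `G`-set with `p'`-stabilizers as a `(1, G)`-biset, with `x g = g⁻¹ x`. -/
def Biset.ofRight (Ω : Type u) [Finite Ω] [MulAction G Ω]
    (h : ∀ x : Ω, IsPPrimeGroup p (MulAction.stabilizer G x)) : Biset p Triv.{u} G where
  carrier := Ω
  left := { smul := fun _ x => x, one_smul := fun _ => rfl, mul_smul := fun _ _ _ => rfl }
  right := MulAction.compHom Ω (MulEquiv.inv' G).symm.toMonoidHom
  comm := @SMulCommClass.mk _ _ _ ⟨fun _ x => x⟩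
    (MulAction.compHom Ω (MulEquiv.inv' G).symm.toMonoidHom).toSMul fun _ _ _ => rfl
  left_stabilizer _ := isPPrimeGroup_of_subsingleton
  right_stabilizer x := by
    let _ : MulAction Gᵐᵒᵖ Ω := MulAction.compHom Ω (MulEquiv.inv' G).symm.toMonoidHom
    have card_eq : Nat.card (MulAction.stabilizer Gᵐᵒᵖ x) = Nat.card (MulAction.stabilizer G x) :=
      Nat.card_congr ((MulEquiv.inv' G).symm.toEquiv.subtypeEquiv fun _ => Iff.rfl)
    exact (congrArg (fun n => n.Coprime p) card_eq).mpr (h x)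

variable {Ω : Type u} [Finite Ω] [MulAction G Ω]
  (h : ∀ x : Ω, IsPPrimeGroup p (MulAction.stabilizer G x)) (C : Subgroup G)

theorem Biset.mark_ofLeft :
    (Biset.ofLeft Ω h).mark (C.map (MonoidHom.inl G Triv)) =
      Nat.card (MulAction.fixedPoints C Ω) :=
  Nat.card_congr (Equiv.subtypeEquivRight fun x => mem_fixedPoints_map.trans
    (forall_congr' fun c => Eq.congr_left ((Biset.ofLeft Ω h).inl_smul c x)))

theorem Biset.mark_ofRight :
    (Biset.ofRight Ω h).mark (C.map (MonoidHom.inr Triv G)) =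
      Nat.card (MulAction.fixedPoints C Ω) :=
  have inr_smul (c : G) (x : Ω) :
      MonoidHom.inr Triv G c • (show (Biset.ofRight Ω h).carrier from x) = c • x :=
    ((Biset.ofRight Ω h).inr_smul c x).trans (congrArg (· • x) (inv_inv c))
  Nat.card_congr (Equiv.subtypeEquivRight fun x => mem_fixedPoints_map.trans
    (forall_congr' fun c => Eq.congr_left (inr_smul c x)))

end GSets

section Classes

/-- The conjugacy classes of cyclic `p'`-subgroups of `G`. -/
abbrev CyclicPPrimeClass (p : ℕ) (G : Type u) [Group G] : Type u :=
  Quotient (conjSetoid p G)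

variable {p : ℕ} {A : Type w} [Group A]

/-- The order of the subgroups in a conjugacy class of cyclic `p'`-subgroups. -/
def classOrder : CyclicPPrimeClass p A → ℕ :=
  Quotient.lift (fun C => Nat.card C.1) fun _ _ ⟨a, h⟩ => by
    rw [h, Subgroup.card_map_of_injective (MulAut.conj a).injective]

/-- The subgroups that belong to a conjugacy class of cyclic `p'`-subgroups. -/
def classMembers (q : CyclicPPrimeClass p A) : Set (Subgroup A) :=
  Subtype.val '' {C : CyclicPPrimeSubgroup p A | Quotient.mk (conjSetoid p A) C = q}

theorem classOrder_pos [Finite A] (q : CyclicPPrimeClass p A) : 0 < classOrder q :=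
  Quotient.inductionOn q fun _ => Nat.card_pos

theorem mem_classMembers_iff (C : CyclicPPrimeSubgroup p A) (q : CyclicPPrimeClass p A) :
    C.1 ∈ classMembers q ↔ Quotient.mk (conjSetoid p A) C = q :=
  Subtype.val_injective.mem_set_image

theorem card_classMembers_dvd (q : CyclicPPrimeClass p A) :
    Nat.card (classMembers q) ∣ Nat.card A := by
  induction q using Quotient.inductionOn with | _ C
  have members_eq : classMembers (Quotient.mk (conjSetoid p A) C) =
      Set.range fun a : A => C.1.map (MulAut.conj a).toMonoidHom := by
    ext D
    constructor
    · rintro ⟨D, hD, rfl⟩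
      obtain ⟨a, ha⟩ := Quotient.exact hD.symm
      exact ⟨a, ha.symm⟩
    · rintro ⟨a, rfl⟩
      have e := C.1.equivMapOfInjective (MulAut.conj a).toMonoidHom (MulAut.conj a).injective
      have := C.2.1
      exact ⟨⟨_, isCyclic_of_surjective e e.surjective, C.2.2.map_conj a⟩,
        (Quotient.sound (s := conjSetoid p A) ⟨a, rfl⟩).symm, rfl⟩
  rw [members_eq]
  exact card_conjugates_dvd C.1

theorem card_generators_classMembers [Finite A] (q : CyclicPPrimeClass p A) :
    Nat.card {a : A // Subgroup.zpowers a ∈ classMembers q} =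
      Nat.card (classMembers q) * (classOrder q).totient := by
  refine card_zpowers_mem_eq_mul_totient _ ?_
  rintro _ ⟨C, rfl, rfl⟩
  exact ⟨C.2.1, rfl⟩

theorem sum_zpowers_eq_sum_classes {M : Type*} [AddCommMonoid M] [Fintype A]
    [Fintype (CyclicPPrimeClass p A)] (F : Subgroup A → M) (F' : CyclicPPrimeClass p A → M)
    (hF : ∀ C : CyclicPPrimeSubgroup p A, F C.1 = F' (Quotient.mk _ C))
    (hzero : ∀ C : Subgroup A, ¬ IsPPrimeGroup p C → F C = 0) :
    ∑ a : A, F (Subgroup.zpowers a) =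
      ∑ q, (Nat.card (classMembers q) * (classOrder q).totient) • F' q := by
  classical
  have apply_zpowers (a : A) : F (Subgroup.zpowers a) =
      ∑ q, if Subgroup.zpowers a ∈ classMembers q then F' q else 0 := by
    by_cases ha : IsPPrimeGroup p (Subgroup.zpowers a)
    · let C : CyclicPPrimeSubgroup p A := ⟨Subgroup.zpowers a, inferInstance, ha⟩
      change F C.1 = ∑ q, if C.1 ∈ classMembers q then F' q else 0
      simp only [mem_classMembers_iff, hF, Finset.sum_ite_eq, Finset.mem_univ, if_true]
    · rw [hzero _ ha, Finset.sum_eq_zero fun q _ => if_neg ?_]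
      rintro ⟨C, -, hC⟩
      exact ha (hC ▸ C.2.2)
  simp only [apply_zpowers]
  rw [Finset.sum_comm]
  refine Finset.sum_congr rfl fun q _ => ?_
  rw [← Finset.sum_filter, Finset.sum_const, ← card_generators_classMembers, ← Fintype.card_subtype,
    Nat.card_eq_fintype_card]

theorem card_lt_card_of_nonempty_fixedPoints [Finite A] {C D : CyclicPPrimeSubgroup p A}
    (hne : Quotient.mk (conjSetoid p A) C ≠ Quotient.mk _ D)
    (h : (MulAction.fixedPoints C.1 (A ⧸ D.1)).Nonempty) : Nat.card C.1 < Nat.card D.1 := by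
  obtain ⟨a, ha⟩ := exists_le_map_conj_of_nonempty_fixedPoints h
  have hcard : Nat.card (D.1.map (MulAut.conj a).toMonoidHom) = Nat.card D.1 :=
    Subgroup.card_map_of_injective (MulAut.conj a).injective
  refine hcard ▸ (Subgroup.card_le_of_le ha).lt_of_ne fun heq => ?_
  exact hne (Quotient.sound (s := conjSetoid p A)
    ⟨a, (Subgroup.eq_of_le_of_card_ge ha heq.ge)⟩).symm

variable {H G : Type u} [Group H] [Group G]

/-- The vector of marks of a biset at the images under `f : A →* H × G` of the classes of cyclic
`p'`-subgroups of `A`, as a linear map on `R B^Δ(H, G)`. -/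
def RB.classMark (R : Type v) [CommRing R] (f : A →* H × G) :
    RB p R H G →ₗ[R] CyclicPPrimeClass p A → R :=
  LinearMap.pi (Quotient.lift (fun C => RB.mark R (C.1.map f)) fun C D ⟨a, h⟩ => by
    have map_conj : (C.1.map (MulAut.conj a).toMonoidHom).map f =
        (C.1.map f).map (MulAut.conj (f a)).toMonoidHom := by
      rw [Subgroup.map_map, Subgroup.map_map]
      congr 1
      ext <;> simp
    rw [h, map_conj, RB.mark_map_conj])

theorem RB.classMark_cls_mk {R : Type v} [CommRing R] (f : A →* H × G) (X : Biset p H G)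
    (C : CyclicPPrimeSubgroup p A) :
    RB.classMark R f (1 ⊗ₜ X.cls) (Quotient.mk _ C) = X.mark (C.1.map f) :=
  RB.mark_cls R _ X

theorem RB.classMark_surjective {𝕂 : Type v} [Field 𝕂] [Finite A] (hA : (Nat.card A : 𝕂) ≠ 0)
    (f : A →* H × G) (T : CyclicPPrimeSubgroup p A → Biset p H G)
    (hT : ∀ C D : CyclicPPrimeSubgroup p A,
      (T D).mark (C.1.map f) = Nat.card (MulAction.fixedPoints C.1 (A ⧸ D.1))) :
    Function.Surjective (RB.classMark (p := p) 𝕂 f) := by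
  have classMark_apply (D : CyclicPPrimeSubgroup p A) (q : CyclicPPrimeClass p A) :
      RB.classMark 𝕂 f (1 ⊗ₜ (T D).cls) q =
        Nat.card (MulAction.fixedPoints q.out.1 (A ⧸ D.1)) := by
    rw [← hT, ← RB.classMark_cls_mk, q.out_eq]
  have span_eq := span_range_eq_top_of_triangular classOrder
    (fun q : CyclicPPrimeClass p A => RB.classMark 𝕂 f (1 ⊗ₜ (T q.out).cls)) ?_ ?_
  · rw [← LinearMap.range_eq_top, eq_top_iff, ← span_eq, Submodule.span_le]
    rintro _ ⟨q, rfl⟩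
    exact ⟨_, rfl⟩
  · intro q hq
    rw [classMark_apply] at hq
    exact ne_zero_of_dvd_ne_zero hA
      (Nat.cast_dvd_cast (card_fixedPoints_quotient_self_dvd q.out.1)) hq
  · intro q r hrq hne
    rw [classMark_apply] at hne
    rw [← q.out_eq, ← r.out_eq] at hrq ⊢
    have hcard := ne_of_apply_ne Nat.cast (hne.trans_eq Nat.cast_zero.symm)
    exact card_lt_card_of_nonempty_fixedPoints hrq
      (Set.nonempty_coe_sort.mp (Nat.card_ne_zero.mp hcard).1)

end Classes

section Evaluation

variable {p : ℕ} {G : Type u} [Group G]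

theorem natCast_card_comp_mul_card {R : Type v} [CommRing R] [Finite G]
    [Fintype (CyclicPPrimeClass p G)] (Y : Biset p Triv.{u} G) (X : Biset p G Triv.{u}) :
    (Nat.card (Y.comp X).carrier * Nat.card G : R) =
      ∑ q : CyclicPPrimeClass p G, (Nat.card (classMembers q) * (classOrder q).totient) •
        (RB.classMark R (MonoidHom.inr Triv G) (1 ⊗ₜ Y.cls) q *
          RB.classMark R (MonoidHom.inl G Triv) (1 ⊗ₜ X.cls) q) := by
  have := Fintype.ofFinite G
  rw [← sum_zpowers_eq_sum_classes (fun C => (Y.mark (C.map (MonoidHom.inr Triv G)) *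
    X.mark (C.map (MonoidHom.inl G Triv)) : R)), ← Nat.cast_mul, Biset.card_comp_mul_card]
  · simp only [Biset.mark_map_zpowers, Nat.cast_sum, Nat.cast_mul]
  · simp only [RB.classMark_cls_mk, implies_true]
  · intro C hC
    rw [X.mark_map_inl_eq_zero hC, Nat.cast_zero, mul_zero]

theorem augLinear_comp_mul_card {R : Type v} [CommRing R] [Finite G]
    [Fintype (CyclicPPrimeClass p G)] (y : RB p R Triv.{u} G) (x : RB p R G Triv.{u}) :
    augLinear p R (RB.comp p R _ _ _ y x) * Nat.card G =
      ∑ q : CyclicPPrimeClass p G, (Nat.card (classMembers q) * (classOrder q).totient) •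
        (RB.classMark R (MonoidHom.inr Triv G) y q *
          RB.classMark R (MonoidHom.inl G Triv) x q) := by
  let pairing : RB p R Triv.{u} G →ₗ[R] RB p R G Triv.{u} →ₗ[R] R :=
    (RB.comp p R _ _ _).compr₂ (LinearMap.mulRight R (Nat.card G : R) ∘ₗ augLinear p R)
  let diagonal : RB p R Triv.{u} G →ₗ[R] RB p R G Triv.{u} →ₗ[R] R :=
    ∑ q : CyclicPPrimeClass p G, (Nat.card (classMembers q) * (classOrder q).totient) •
      (LinearMap.mul R R).compl₁₂ (LinearMap.proj q ∘ₗ RB.classMark R (MonoidHom.inr Triv G))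
        (LinearMap.proj q ∘ₗ RB.classMark R (MonoidHom.inl G Triv))
  have pairing_eq : pairing = diagonal := by
    refine RB.hom_ext fun Y => RB.hom_ext fun X => ?_
    have h := natCast_card_comp_mul_card (R := R) Y X
    rw [← augLinear_cls, ← RB.comp_cls] at h
    simpa [pairing, diagonal] using h
  simpa [pairing, diagonal] using LinearMap.congr_fun₂ pairing_eq y x

/-- The map `x ↦ x ⊗ 1` from `R B^Δ(G, 1)` to `L_{1,R}(G) = R B^Δ(G, 1) ⊗ R`, the tensor product
being taken over `E_1`. -/
def L.ofTrivial (p : ℕ) (R : Type v) [CommRing R] (G : Type u) [Group G] [Finite G] :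
    RB p R G Triv.{u} →ₗ[R] L (trivialModule.{u, v} p R) ⟨G⟩ :=
  Submodule.mkQ _ ∘ₗ (TensorProduct.rid R (RB p R G Triv.{u})).symm.toLinearMap

theorem L.ofTrivial_surjective (p : ℕ) (R : Type v) [CommRing R] (G : Type u) [Group G]
    [Finite G] : Function.Surjective (L.ofTrivial p R G) :=
  (Submodule.mkQ_surjective _).comp (TensorProduct.rid R (RB p R G Triv.{u})).symm.surjective

theorem L.eval_ofTrivial {R : Type v} [CommRing R] [Finite G] (y : RB p R Triv.{u} G)
    (x : RB p R G Triv.{u}) :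
    L.eval (trivialModule.{u, v} p R) (H := ⟨G⟩) y (L.ofTrivial p R G x) =
      augLinear p R (RB.comp p R _ _ _ y x) :=
  mul_one (augLinear p R (RB.comp p R _ _ _ y x))

theorem RB.classMark_inl_surjective {𝕂 : Type v} [Field 𝕂] [Finite G]
    (hG : (Nat.card G : 𝕂) ≠ 0) :
    Function.Surjective (RB.classMark (p := p) 𝕂 (MonoidHom.inl G Triv.{u})) :=
  RB.classMark_surjective hG _ (fun D => Biset.ofLeft (G ⧸ D.1) D.2.2.stabilizer_quotient)
    fun _ _ => Biset.mark_ofLeft _ _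

theorem RB.classMark_inr_surjective {𝕂 : Type v} [Field 𝕂] [Finite G]
    (hG : (Nat.card G : 𝕂) ≠ 0) :
    Function.Surjective (RB.classMark (p := p) 𝕂 (MonoidHom.inr Triv.{u} G)) :=
  RB.classMark_surjective hG _ (fun D => Biset.ofRight (G ⧸ D.1) D.2.2.stabilizer_quotient)
    fun _ _ => Biset.mark_ofRight _ _

theorem nonempty_sTrivial_equiv {𝕂 : Type v} [Field 𝕂] [Finite G] (hG : (Nat.card G : 𝕂) ≠ 0) :
    Nonempty ((STrivial.{u, v} p 𝕂).obj ⟨G⟩ ≃ₗ[𝕂]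
      ({q : CyclicPPrimeClass p G // ((classOrder q).totient : 𝕂) ≠ 0} → 𝕂)) := by
  have := Fintype.ofFinite (CyclicPPrimeClass p G)
  let weight (q : CyclicPPrimeClass p G) : 𝕂 :=
    (Nat.card (classMembers q) * (classOrder q).totient : ℕ) / Nat.card G
  have weight_ne_zero_iff (q) : weight q ≠ 0 ↔ ((classOrder q).totient : 𝕂) ≠ 0 := by
    have hq : (Nat.card (classMembers q) : 𝕂) ≠ 0 :=
      ne_zero_of_dvd_ne_zero hG (Nat.cast_dvd_cast (card_classMembers_dvd q))
    rw [div_ne_zero_iff, Nat.cast_mul, mul_ne_zero_iff]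
    exact ⟨fun h => h.1.2, fun h => ⟨⟨hq, h⟩, hG⟩⟩
  obtain ⟨e⟩ := nonempty_quotient_iInf_ker_equiv (L.ofTrivial_surjective p 𝕂 G)
    (RB.classMark_inl_surjective hG) (RB.classMark_inr_surjective hG) weight fun y x => by
      rw [L.eval_ofTrivial, eq_div_of_mul_eq hG (augLinear_comp_mul_card y x), Finset.sum_div]
      exact Finset.sum_congr rfl fun q _ => by rw [nsmul_eq_mul, div_mul_eq_mul_div]
  exact ⟨e ≪≫ₗ LinearEquiv.funCongrLeft 𝕂 𝕂
    (Equiv.subtypeEquivRight fun q => (weight_ne_zero_iff q).symm)⟩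

end Evaluation

end PBifree

end

theorem mainTheorem4_general (p : ℕ) (𝕂 : Type v) [Field 𝕂] (G : Type u) [Group G] [Finite G]
    (hG : (Nat.card G : 𝕂) ≠ 0) :
    Module.Finite 𝕂 ((PBifree.STrivial.{u, v} p 𝕂).obj ⟨G⟩) ∧
      Module.finrank 𝕂 ((PBifree.STrivial.{u, v} p 𝕂).obj ⟨G⟩) =
        Nat.card {q : Quotient (PBifree.conjSetoid p G) //
          ((PBifree.classOrder q).totient : 𝕂) ≠ 0} := by
  obtain ⟨e⟩ := PBifree.nonempty_sTrivial_equiv (p := p) hG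
  have := Fintype.ofFinite {q : Quotient (PBifree.conjSetoid p G) //
    ((PBifree.classOrder q).totient : 𝕂) ≠ 0}
  refine ⟨Module.Finite.equiv e.symm, e.finrank_eq.trans ?_⟩
  rw [Module.finrank_fintype_fun_eq_card, Nat.card_eq_fintype_card]

/-- The dimension of the evaluation at `G` of the simple `p`-bifree biset functor attached to the
trivial group and the trivial module is the number of conjugacy classes of cyclic `p'`-subgroups
of `G`. -/
theorem mainTheorem4 (p : ℕ) (hp : p.Prime) (𝕂 : Type v) [Field 𝕂] [CharZero 𝕂]
    (G : Type u) [Group G] [Finite G] :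
    Module.Finite 𝕂 ((PBifree.STrivial.{u, v} p 𝕂).obj ⟨G⟩) ∧
      Module.finrank 𝕂 ((PBifree.STrivial.{u, v} p 𝕂).obj ⟨G⟩) =
        Nat.card (Quotient (PBifree.conjSetoid p G)) := by
  obtain ⟨finite, finrank_eq⟩ :=
    mainTheorem4_general p 𝕂 G (Nat.cast_ne_zero.mpr Nat.card_pos.ne')
  exact ⟨finite, finrank_eq.trans (Nat.card_congr (Equiv.subtypeUnivEquiv fun q =>
    Nat.cast_ne_zero.mpr (Nat.totient_pos.mpr (PBifree.classOrder_pos q)).ne'))⟩
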